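/- All graphs are finite, without loops or parallel edges. A longest path of a graph $G$ is a path of $G$ whose length (number of edges) is maximum among all paths of $G$. For a connected graph $G$, let $\mathsf{lpt}(G)$ denote the minimum cardinality of a set $S\subseteq V(G)$ such that every longest path of $G$ contains at least one vertex of $S$. The bull is the graph obtained from a four-vertex path by adding a vertex adjacent to exactly the two middle vertices of the path; the chair is the graph obtained from the claw $K_{1,3}$ by subdividing one edge exactly once. A graph is (bull, chair)-free if no induced subgraph of it is isomorphic to the bull or to the chair. Theorem. Every connected (bull, chair)-free graph $G$ satisfies $\mathsf{lpt}(G)\le 5$. -/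

import Mathlib

namespace LongestPaths

/-- The chair: the claw with center `0` and leaves `1`, `2`, `4`, whose edge between `0` and `4`
is subdivided once by the vertex `3`. -/
def chair : SimpleGraph (Fin 5) :=
  SimpleGraph.fromEdgeSet {s(0, 1), s(0, 2), s(0, 3), s(3, 4)}

/-- The bull: the four-vertex path on `0`, `1`, `2`, `3` together with the vertex `4`, which is
adjacent to the two middle vertices of the path. -/
def bull : SimpleGraph (Fin 5) :=
  SimpleGraph.fromEdgeSet {s(0, 1), s(1, 2), s(2, 3), s(4, 1), s(4, 2)}

/-- `G` is `H`-free: `G` has no induced subgraph isomorphic to `H`. -/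
def IsFree {V W : Type*} (H : SimpleGraph W) (G : SimpleGraph V) : Prop :=
  ¬ H.IsIndContained G

/-- A longest path: a path whose length is the maximum of the lengths of all paths of `G`. -/
def IsLongestPath {V : Type*} (G : SimpleGraph V) {u v : V} (p : G.Walk u v) : Prop :=
  p.IsPath ∧ ∀ (x y : V) (q : G.Walk x y), q.IsPath → q.length ≤ p.length

/-- A longest path transversal: a set of vertices that meets every longest path of `G`. -/
def IsLongestPathTransversal {V : Type*} (G : SimpleGraph V) (S : Finset V) : Prop :=
  ∀ (u v : V) (p : G.Walk u v), IsLongestPath G p → ∃ w ∈ S, w ∈ p.support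

/-- The longest path transversal number of a finite graph `G`: the minimum cardinality of a
longest path transversal (the minimum is attained, see `exists_card_eq_lpt`). -/
noncomputable def lpt {V : Type*} (G : SimpleGraph V) : ℕ :=
  sInf {n : ℕ | ∃ S : Finset V, IsLongestPathTransversal G S ∧ S.card = n}

theorem exists_card_eq_lpt {V : Type*} [Fintype V] (G : SimpleGraph V) :
    ∃ S : Finset V, IsLongestPathTransversal G S ∧ S.card = lpt G :=
  Nat.sInf_mem (s := {n : ℕ | ∃ S : Finset V, IsLongestPathTransversal G S ∧ S.card = n})
    ⟨_, Finset.univ, fun u _ p _ => ⟨u, Finset.mem_univ u, p.start_mem_support⟩, rfl⟩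

end LongestPaths

/-! A dominating set meets every longest path: an end of a path avoiding it could be extended into
it. Hence five dominating vertices suffice, and so does any single vertex when there is a
Hamiltonian path.

Suppose there is an induced claw. Call a vertex far if it is neither in the claw nor adjacent to it.
A near vertex with a far neighbor sees at least two leaves (`IsClaw.two_leaves`), and every far
vertex has a near neighbor (`IsClaw.exists_adj_of_far`). Near vertices with pairwise incomparable
far neighborhoods are pairwise nonadjacent and see the same leaves, so three of them, with a common
leaf as center, yield a chair. Therefore at most two near vertices, chosen with maximal far
neighborhoods, cover all far vertices. They dominate together with the whole claw if one is enough,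
and with its leaves alone if two are needed (`IsClaw.exists_dominating`).

Suppose there is no induced claw. Without an independent triple, a nonadjacent pair, or any vertex
of a complete graph, dominates. Otherwise there is an induced path on five vertices. Relative to a
longest induced path, every vertex is a true twin of a path vertex or sees exactly the two ends
(`IsInducedPath.isTwinAt_or_closesCycle`). These classes are cliques and consecutive ones are
completely joined, so listing them in order gives a Hamiltonian path. -/

namespace LongestPaths

open SimpleGraph

/-! ### Forbidden induced subgraphs as adjacency patterns -/

section Patterns

variable {V : Type*} {G : SimpleGraph V}

/-- A chair-free graph contains no chair with center `c`, leaves `a`, `b` and long branch `d`, `e`. -/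
theorem IsFree.not_chair (h : IsFree chair G) {c a b d e : V} (hca : G.Adj c a) (hcb : G.Adj c b)
    (hcd : G.Adj c d) (hde : G.Adj d e) (hne : a ≠ b) (hab : ¬ G.Adj a b) (had : ¬ G.Adj a d)
    (hbd : ¬ G.Adj b d) (hce : ¬ G.Adj c e) (hae : ¬ G.Adj a e) (hbe : ¬ G.Adj b e) : False := by
  refine h ⟨⟨⟨![c, a, b, d, e], ?_⟩, ?_⟩⟩
  · intro i j hij
    -- The adjacencies separate every pair of vertices except the leaves `a` and `b`, which are
    -- twins in the chair; only there is `hne` needed.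
    fin_cases i <;> fin_cases j <;> simp at hij ⊢ <;> subst hij <;> simp_all [G.adj_comm]
  · intro i j
    change G.Adj (![c, a, b, d, e] i) (![c, a, b, d, e] j) ↔ chair.Adj i j
    fin_cases i <;> fin_cases j <;>
      simp [chair, hca, hcb, hcd, hde, hab, had, hbd, hce, hae, hbe, hca.symm, hcb.symm, hcd.symm,
        hde.symm, G.adj_comm b a, G.adj_comm d a, G.adj_comm d b, G.adj_comm e c, G.adj_comm e a,
        G.adj_comm e b]

/-- A bull-free graph contains no bull with path `p`, `q`, `r`, `s` and extra vertex `t`. -/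
theorem IsFree.not_bull (h : IsFree bull G) {p q r s t : V} (hpq : G.Adj p q) (hqr : G.Adj q r)
    (hrs : G.Adj r s) (htq : G.Adj t q) (htr : G.Adj t r) (hpr : ¬ G.Adj p r) (hps : ¬ G.Adj p s)
    (hqs : ¬ G.Adj q s) (htp : ¬ G.Adj t p) (hts : ¬ G.Adj t s) : False := by
  refine h ⟨⟨⟨![p, q, r, s, t], ?_⟩, ?_⟩⟩
  · intro i j hij
    fin_cases i <;> fin_cases j <;> simp at hij ⊢ <;> subst hij <;> simp_all [G.adj_comm]
  · intro i j
    change G.Adj (![p, q, r, s, t] i) (![p, q, r, s, t] j) ↔ bull.Adj i j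
    fin_cases i <;> fin_cases j <;>
      simp [bull, hpq, hqr, hrs, htq, htr, hpr, hps, hqs, htp, hts, hpq.symm, hqr.symm, hrs.symm,
        htq.symm, htr.symm, G.adj_comm r p, G.adj_comm s p, G.adj_comm s q, G.adj_comm p t,
        G.adj_comm s t]

end Patterns

/-! ### Sufficient conditions for a small transversal -/

section Transversals

variable {V : Type*} {G : SimpleGraph V}

theorem IsLongestPathTransversal.lpt_le {S : Finset V} (hS : IsLongestPathTransversal G S) :
    lpt G ≤ S.card :=
  Nat.sInf_le ⟨S, hS, rfl⟩

/-- A dominating set meets every longest path, since an end of a path that avoids it has a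
neighbor off the path. -/
theorem isLongestPathTransversal_of_dominating {S : Finset V}
    (hS : ∀ v, v ∈ S ∨ ∃ s ∈ S, G.Adj s v) : IsLongestPathTransversal G S := by
  intro u v p hp
  rcases hS u with hu | ⟨s, hs, hsu⟩
  · exact ⟨u, hu, p.start_mem_support⟩
  · refine ⟨s, hs, ?_⟩
    by_contra hsp
    have := hp.2 _ _ (Walk.cons hsu p) ((Walk.cons_isPath_iff _ _).2 ⟨hp.1, hsp⟩)
    simp at this

theorem exists_walk_support_eq_of_isChain :
    ∀ (l : List V), l ≠ [] → l.IsChain G.Adj → ∃ (u v : V) (p : G.Walk u v), p.support = l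
  | [], h, _ => (h rfl).elim
  | [a], _, _ => ⟨a, a, Walk.nil, rfl⟩
  | a :: b :: l, _, h => by
    rw [List.isChain_cons_cons] at h
    obtain ⟨u, v, p, hp⟩ := exists_walk_support_eq_of_isChain (b :: l) (by simp) h.2
    obtain rfl : u = b := by
      rw [← Walk.cons_tail_support] at hp
      exact (List.cons.inj hp).1
    exact ⟨a, v, Walk.cons h.1 p, by simp [hp]⟩

/-- If the vertices can be listed in a Hamiltonian path, then every vertex meets all longest
paths. -/
theorem isLongestPathTransversal_singleton_of_isChain [Fintype V] {l : List V}
    (hchain : l.IsChain G.Adj) (hnodup : l.Nodup) (hall : ∀ v, v ∈ l) (w : V) :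
    IsLongestPathTransversal G {w} := by
  classical
  intro u v p hp
  refine ⟨w, by simp, ?_⟩
  obtain ⟨x, y, q, hq⟩ := exists_walk_support_eq_of_isChain l (List.ne_nil_of_mem (hall w)) hchain
  have hlen := hp.2 x y q (by rw [Walk.isPath_def, hq]; exact hnodup)
  have hl : l.length = Fintype.card V := by
    rw [← List.toFinset_card_of_nodup hnodup, ← Finset.card_univ]
    congr 1
    ext v
    simp [hall v]
  have h1 : p.support.toFinset = Finset.univ := by
    apply Finset.eq_univ_of_card
    apply le_antisymm (Finset.card_le_univ _)
    rw [List.toFinset_card_of_nodup hp.1.support_nodup, Walk.length_support]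
    have := congrArg List.length hq
    rw [Walk.length_support] at this
    omega
  have := Finset.mem_univ w
  rw [← h1] at this
  simpa using this

end Transversals

/-! ### Hamiltonian paths through consecutive cliques -/

section Hamiltonian

variable {V : Type*} [Fintype V] {G : SimpleGraph V}

/-- If the vertex set is split into consecutive nonempty cliques `f ⁻¹' {i}` such that consecutive
cliques are completely joined, then the graph has a Hamiltonian path. -/
theorem exists_hamiltonian_list_of_levels (f : V → ℕ) (n : ℕ)
    (hsame : ∀ u v, u ≠ v → f u = f v → G.Adj u v)
    (hsucc : ∀ u v, f v = f u + 1 → G.Adj u v) (hne : ∀ i ≤ n, ∃ v, f v = i) :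
    ∃ l : List V, l.IsChain G.Adj ∧ l.Nodup ∧ ∀ v, v ∈ l ↔ f v ≤ n := by
  classical
  have level : ∀ i, ((Finset.univ.filter fun v => f v = i).toList).IsChain G.Adj := by
    intro i
    apply List.Pairwise.isChain
    refine (Finset.nodup_toList _).imp_of_mem ?_
    intro a b ha hb hab
    simp at ha hb
    exact hsame a b hab (by omega)
  -- The clause on the last vertex lets the next clique be appended; nonemptiness of the levels
  -- preserves it.
  suffices H : ∀ m ≤ n, ∃ l : List V, l.IsChain G.Adj ∧ l.Nodup ∧ (∀ v, v ∈ l ↔ f v ≤ m) ∧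
      ∀ x ∈ l.getLast?, f x = m by
    obtain ⟨l, h1, h2, h3, -⟩ := H n le_rfl
    exact ⟨l, h1, h2, h3⟩
  intro m
  induction m with
  | zero =>
    intro _
    refine ⟨_, level 0, Finset.nodup_toList _, by simp, ?_⟩
    intro x hx
    simpa using List.mem_of_getLast? hx
  | succ m ih =>
    intro hm
    obtain ⟨l, h1, h2, h3, h4⟩ := ih (by omega)
    refine ⟨l ++ (Finset.univ.filter fun v => f v = m + 1).toList, ?_, ?_, ?_, ?_⟩
    · refine List.isChain_append.2 ⟨h1, level _, ?_⟩
      intro x hx y hy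
      have hy' := List.mem_of_head? hy
      simp at hy'
      exact hsucc x y (by rw [h4 x hx, hy'])
    · refine List.nodup_append.2 ⟨h2, Finset.nodup_toList _, ?_⟩
      rintro a ha b hb rfl
      rw [h3] at ha
      simp at hb
      omega
    · intro v
      simp [h3]
      omega
    · intro x hx
      have hnil : (Finset.univ.filter fun v => f v = m + 1).toList ≠ [] := by
        obtain ⟨v, hv⟩ := hne (m + 1) hm
        exact List.ne_nil_of_mem (a := v) (by simp [hv])
      rw [List.getLast?_append_of_ne_nil _ hnil] at hx
      simpa using List.mem_of_getLast? hx

end Hamiltonian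

/-- A property that holds at a vertex and passes along edges holds on a connected graph. -/
theorem forall_of_connected {V : Type*} {G : SimpleGraph V} (hG : G.Connected) {p : V → Prop}
    {r : V} (hr : p r) (hstep : ∀ u v, p u → G.Adj u v → p v) (v : V) : p v := by
  obtain ⟨w⟩ := hG.preconnected r v
  induction w with
  | nil => exact hr
  | cons h _ ih => exact ih (hstep _ _ hr h)

/-! ### Graphs with an induced claw: five dominating vertices -/

section Claw

variable {V : Type*} {G : SimpleGraph V}

/-- `c` is the center of an induced claw with leaves `a`, `b`, `d`. -/
structure IsClaw (G : SimpleGraph V) (c a b d : V) : Prop where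
  ca : G.Adj c a
  cb : G.Adj c b
  cd : G.Adj c d
  ne_ab : a ≠ b
  ne_ad : a ≠ d
  ne_bd : b ≠ d
  ab : ¬ G.Adj a b
  ad : ¬ G.Adj a d
  bd : ¬ G.Adj b d

theorem IsClaw.rotate {c a b d : V} (h : IsClaw G c a b d) : IsClaw G c b d a :=
  ⟨h.cb, h.cd, h.ca, h.ne_bd, h.ne_ab.symm, h.ne_ad.symm, h.bd, fun h' => h.ab h'.symm,
    fun h' => h.ad h'.symm⟩

/-- `v` is neither in the set `{c, a, b, d}` nor adjacent to it. -/
structure IsFar (G : SimpleGraph V) (c a b d v : V) : Prop where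
  ne_c : v ≠ c
  ne_a : v ≠ a
  ne_b : v ≠ b
  ne_d : v ≠ d
  c : ¬ G.Adj c v
  a : ¬ G.Adj a v
  b : ¬ G.Adj b v
  d : ¬ G.Adj d v

theorem IsFar.rotate {c a b d v : V} (h : IsFar G c a b d v) : IsFar G c b d a v :=
  ⟨h.ne_c, h.ne_b, h.ne_d, h.ne_a, h.c, h.b, h.d, h.a⟩

variable {c a b d : V}

/-- Otherwise the path `v`, `u`, `c`, `d` with `a` attached to `u` and `c` is a bull. The leaf `b`
plays no role, so rotations of the claw carry adjacency cyclically through the leaves. -/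
theorem IsClaw.leaf_of_adj_center (hbull : IsFree bull G) (hk : IsClaw G c a b d) {u v : V}
    (hv : IsFar G c a b d v) (huv : G.Adj u v) (hcu : G.Adj c u) (hua : G.Adj u a) :
    G.Adj u d := by
  by_contra hud
  exact hbull.not_bull huv.symm hcu.symm hk.cd hua.symm hk.ca.symm (fun h => hv.c h.symm)
    (fun h => hv.d h.symm) hud hv.a hk.ad

/-- A vertex with a neighbor far from a claw is adjacent to at least two leaves, as soon as it is
adjacent to some vertex of the claw. -/
theorem IsClaw.two_leaves (hbull : IsFree bull G) (hchair : IsFree chair G)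
    (hk : IsClaw G c a b d) {u v : V} (hu : ¬ IsFar G c a b d u) (hv : IsFar G c a b d v)
    (huv : G.Adj u v) :
    (G.Adj u a ∧ G.Adj u b) ∨ (G.Adj u b ∧ G.Adj u d) ∨ (G.Adj u a ∧ G.Adj u d) := by
  have hk1 := hk.rotate
  have hk2 := hk1.rotate
  have hv1 := hv.rotate
  have hv2 := hv1.rotate
  by_cases hcu : G.Adj c u
  · by_cases hua : G.Adj u a
    · have := hk.leaf_of_adj_center hbull hv huv hcu hua
      exact .inr (.inr ⟨hua, this⟩)
    by_cases hub : G.Adj u b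
    · exact (hua (hk1.leaf_of_adj_center hbull hv1 huv hcu hub)).elim
    · exact (hchair.not_chair hk.ca hk.cb hcu huv hk.ne_ab hk.ab (fun h => hua h.symm)
        (fun h => hub h.symm) hv.c hv.a hv.b).elim
  -- If `u` saw only the leaf `a`, then `c` with leaves `b`, `d` and long branch `a`, `u` would be a
  -- chair.
  · have aux : ∀ {a b d : V}, IsClaw G c a b d → G.Adj u a → ¬ G.Adj u b → G.Adj u d := by
      intro a b d hk hua hub
      by_contra hud
      exact hchair.not_chair hk.cb hk.cd hk.ca hua.symm hk.ne_bd hk.bd (fun h => hk.ab h.symm)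
        (fun h => hk.ad h.symm) hcu (fun h => hub h.symm) (fun h => hud h.symm)
    have a1 := aux hk
    have a2 := aux hk1
    have a3 := aux hk2
    have : G.Adj u a ∨ G.Adj u b ∨ G.Adj u d := by
      by_contra hno
      push Not at hno
      refine hu ⟨?_, ?_, ?_, ?_, hcu, fun h => hno.1 h.symm, fun h => hno.2.1 h.symm,
        fun h => hno.2.2 h.symm⟩
      · rintro rfl; exact hv.c huv
      · rintro rfl; exact hv.a huv
      · rintro rfl; exact hv.b huv
      · rintro rfl; exact hv.d huv
    tauto

/-- Two leaves adjacent to a vertex which has a neighbor far from the claw. -/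
theorem IsClaw.exists_two_leaves (hbull : IsFree bull G) (hchair : IsFree chair G)
    (hk : IsClaw G c a b d) {u v : V} (hu : ¬ IsFar G c a b d u) (hv : IsFar G c a b d v)
    (huv : G.Adj u v) :
    ∃ x y, x ≠ y ∧ ¬ G.Adj x y ∧ G.Adj u x ∧ G.Adj u y ∧ (x = a ∨ x = b ∨ x = d) ∧
      (y = a ∨ y = b ∨ y = d) := by
  rcases hk.two_leaves hbull hchair hu hv huv with h | h | h
  · exact ⟨a, b, hk.ne_ab, hk.ab, h.1, h.2, by simp, by simp⟩
  · exact ⟨b, d, hk.ne_bd, hk.bd, h.1, h.2, by simp, by simp⟩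
  · exact ⟨a, d, hk.ne_ad, hk.ad, h.1, h.2, by simp, by simp⟩

theorem IsFar.not_adj_leaf {v x : V} (hv : IsFar G c a b d v) (hx : x = a ∨ x = b ∨ x = d) :
    ¬ G.Adj x v := by
  rcases hx with rfl | rfl | rfl
  exacts [hv.a, hv.b, hv.d]

theorem IsClaw.center_adj {x : V} (hk : IsClaw G c a b d) (hx : x = a ∨ x = b ∨ x = d) :
    G.Adj c x := by
  rcases hx with rfl | rfl | rfl
  exacts [hk.ca, hk.cb, hk.cd]

/-- Otherwise `u`, two of its nonadjacent leaves and the branch `v`, `w` form a chair. So the far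
neighborhood of a near vertex is a union of components of the far part. -/
theorem IsClaw.adj_of_far (hbull : IsFree bull G) (hchair : IsFree chair G)
    (hk : IsClaw G c a b d) {u v w : V} (hu : ¬ IsFar G c a b d u) (hv : IsFar G c a b d v)
    (hw : IsFar G c a b d w) (huv : G.Adj u v) (hvw : G.Adj v w) : G.Adj u w := by
  by_contra huw
  obtain ⟨x, y, hne, hxy, hux, huy, hx, hy⟩ := hk.exists_two_leaves hbull hchair hu hv huv
  exact hchair.not_chair hux huy huv hvw hne hxy (hv.not_adj_leaf hx) (hv.not_adj_leaf hy) huw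
    (hw.not_adj_leaf hx) (hw.not_adj_leaf hy)

theorem IsClaw.exists_adj_of_far (hG : G.Connected) (hbull : IsFree bull G)
    (hchair : IsFree chair G) (hk : IsClaw G c a b d) {v : V} (hv : IsFar G c a b d v) :
    ∃ u, ¬ IsFar G c a b d u ∧ G.Adj u v := by
  have key : ∀ w, ¬ IsFar G c a b d w ∨ ∃ u, ¬ IsFar G c a b d u ∧ G.Adj u w := by
    refine forall_of_connected hG (r := c) (.inl fun h => h.ne_c rfl) ?_
    intro w z hw hwz
    by_cases hz : IsFar G c a b d z
    · right
      by_cases hw' : IsFar G c a b d w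
      · obtain ⟨u, hu, huw⟩ := hw.resolve_left (not_not.2 hw')
        exact ⟨u, hu, hk.adj_of_far hbull hchair hu hw' hz huw hwz⟩
      · exact ⟨w, hw', hwz⟩
    · exact .inl hz
  exact (key v).resolve_left (not_not.2 hv)

/-- Two vertices with incomparable far neighborhoods are not adjacent. -/
theorem IsClaw.not_adj_of_private (hbull : IsFree bull G) (hchair : IsFree chair G)
    (hk : IsClaw G c a b d) {u₁ u₂ v₁ v₂ : V} (hu₁ : ¬ IsFar G c a b d u₁)
    (hu₂ : ¬ IsFar G c a b d u₂) (hv₁ : IsFar G c a b d v₁) (hv₂ : IsFar G c a b d v₂)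
    (h11 : G.Adj u₁ v₁) (h22 : G.Adj u₂ v₂) (h12 : ¬ G.Adj u₁ v₂) (h21 : ¬ G.Adj u₂ v₁) :
    ¬ G.Adj u₁ u₂ := by
  intro huu
  have hvv : ¬ G.Adj v₁ v₂ := fun h => h12 (hk.adj_of_far hbull hchair hu₁ hv₁ hv₂ h11 h)
  have h1 := hk.two_leaves hbull hchair hu₁ hv₁ h11
  have h2 := hk.two_leaves hbull hchair hu₂ hv₂ h22
  -- Two pairs of leaves out of three intersect; a common leaf `x` turns the path `v₁`, `u₁`, `u₂`,
  -- `v₂` into a bull.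
  obtain ⟨x, hx, hx1, hx2⟩ : ∃ x, (x = a ∨ x = b ∨ x = d) ∧ G.Adj u₁ x ∧ G.Adj u₂ x := by
    grind
  exact hbull.not_bull h11.symm huu h22 hx1.symm hx2.symm (fun h => h21 h.symm) hvv h12
    (hv₁.not_adj_leaf hx) (hv₂.not_adj_leaf hx)

/-- Two vertices with incomparable far neighborhoods are adjacent to the same leaves. -/
theorem IsClaw.adj_leaf_of_private (hbull : IsFree bull G) (hchair : IsFree chair G)
    (hk : IsClaw G c a b d) {u₁ u₂ v₁ v₂ x : V} (hu₁ : ¬ IsFar G c a b d u₁)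
    (hu₂ : ¬ IsFar G c a b d u₂) (hv₁ : IsFar G c a b d v₁) (hv₂ : IsFar G c a b d v₂)
    (h11 : G.Adj u₁ v₁) (h22 : G.Adj u₂ v₂) (h12 : ¬ G.Adj u₁ v₂) (h21 : ¬ G.Adj u₂ v₁)
    (hx : x = a ∨ x = b ∨ x = d) (hx1 : G.Adj u₁ x) : G.Adj u₂ x := by
  by_contra hx2
  have huu := hk.not_adj_of_private hbull hchair hu₁ hu₂ hv₁ hv₂ h11 h22 h12 h21
  have h1 := hk.two_leaves hbull hchair hu₁ hv₁ h11
  have h2 := hk.two_leaves hbull hchair hu₂ hv₂ h22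
  have := hk.ab
  have := hk.ad
  have := hk.bd
  -- Missing `x`, the vertex `u₂` sees both other leaves, and `u₁` sees one of them. The chair has
  -- center `u₁`, leaves `v₁`, `x` and long branch `y`, `u₂`.
  obtain ⟨y, hy, hy1, hy2, hxy⟩ : ∃ y, (y = a ∨ y = b ∨ y = d) ∧ G.Adj u₁ y ∧ G.Adj u₂ y ∧
      ¬ G.Adj x y := by
    grind [G.adj_comm]
  refine hchair.not_chair h11 hx1 hy1 hy2.symm ?_ (fun h => hv₁.not_adj_leaf hx h.symm)
    (fun h => hv₁.not_adj_leaf hy h.symm) hxy huu (fun h => h21 h.symm) (fun h => hx2 h.symm)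
  rintro rfl
  rcases hx with h | h | h
  exacts [hv₁.ne_a h, hv₁.ne_b h, hv₁.ne_d h]

/-- If two vertices have incomparable far neighborhoods, then together with the leaves of the claw
they dominate every vertex that is adjacent to the center of the claw only. -/
theorem IsClaw.adj_leaf_or_of_adj_center (hbull : IsFree bull G) (hchair : IsFree chair G)
    (hk : IsClaw G c a b d) {u₁ u₂ v₁ v₂ w : V} (hu₁ : ¬ IsFar G c a b d u₁)
    (hu₂ : ¬ IsFar G c a b d u₂) (hv₁ : IsFar G c a b d v₁) (hv₂ : IsFar G c a b d v₂)
    (h11 : G.Adj u₁ v₁) (h22 : G.Adj u₂ v₂) (h12 : ¬ G.Adj u₁ v₂) (h21 : ¬ G.Adj u₂ v₁)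
    (hcw : G.Adj c w) :
    G.Adj a w ∨ G.Adj b w ∨ G.Adj d w ∨ G.Adj u₁ w ∨ G.Adj u₂ w := by
  by_contra hno
  push Not at hno
  obtain ⟨ha, hb, hd, hw1, hw2⟩ := hno
  have hleaf : ∀ x, (x = a ∨ x = b ∨ x = d) → ¬ G.Adj x w := by
    rintro x (rfl | rfl | rfl) <;> assumption
  -- Were `u` adjacent to `c`, the path `w`, `c`, `u`, `v` with a leaf `x` seen by `u` would be a
  -- bull. With `c` thus nonadjacent to `u₁` and `u₂`, a common leaf is the center of a chair with
  -- long branch `c`, `w`.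
  have aux : ∀ {u v : V}, ¬ IsFar G c a b d u → IsFar G c a b d v → G.Adj u v →
      ¬ G.Adj u w → ¬ G.Adj u c := by
    intro u v hu hv huv huw huc
    obtain ⟨x, y, hne, hxy, hux, huy, hx, hy⟩ := hk.exists_two_leaves hbull hchair hu hv huv
    have hvw : ¬ G.Adj v w := fun h =>
      hchair.not_chair hux huy huv h hne hxy (hv.not_adj_leaf hx) (hv.not_adj_leaf hy) huw
        (hleaf x hx) (hleaf y hy)
    exact hbull.not_bull hcw.symm huc.symm huv (hk.center_adj hx).symm hux.symm
      (fun h => huw h.symm) (fun h => hvw h.symm) hv.c (hleaf x hx) (hv.not_adj_leaf hx)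
  obtain ⟨x, y, hne, hxy, hux, huy, hx, hy⟩ := hk.exists_two_leaves hbull hchair hu₁ hv₁ h11
  have hux2 := hk.adj_leaf_of_private hbull hchair hu₁ hu₂ hv₁ hv₂ h11 h22 h12 h21 hx hux
  exact hchair.not_chair hux.symm hux2.symm (hk.center_adj hx).symm hcw
    (fun h => h12 (h ▸ h22)) (hk.not_adj_of_private hbull hchair hu₁ hu₂ hv₁ hv₂ h11 h22 h12 h21)
    (aux hu₁ hv₁ h11 hw1) (aux hu₂ hv₂ h22 hw2) (hleaf x hx) hw1 hw2

/-- A connected (bull, chair)-free graph with an induced claw has a dominating set of at most five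
vertices. -/
theorem IsClaw.exists_dominating [Fintype V] (hG : G.Connected) (hbull : IsFree bull G)
    (hchair : IsFree chair G) (hk : IsClaw G c a b d) :
    ∃ S : Finset V, S.card ≤ 5 ∧ ∀ v, v ∈ S ∨ ∃ s ∈ S, G.Adj s v := by
  classical
  let F : V → Finset V := fun u => Finset.univ.filter fun v => IsFar G c a b d v ∧ G.Adj u v
  have memF : ∀ u v, v ∈ F u ↔ IsFar G c a b d v ∧ G.Adj u v := by simp [F]
  -- A set of at least the same size is not a proper subset, so maximality of a far neighborhood
  -- produces private neighbors.
  have notsub : ∀ {u u' w : V}, (F u').card ≤ (F u).card → w ∈ F u' → w ∉ F u →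
      ∃ v ∈ F u, v ∉ F u' := by
    intro u u' w hle hw hw'
    by_contra hno
    push Not at hno
    have : F u ⊂ F u' := ⟨hno, fun h => hw' (h hw)⟩
    exact absurd (Finset.card_lt_card this) (by omega)
  obtain ⟨u₁, hu₁, hmax₁⟩ := Finset.exists_max_image
    (Finset.univ.filter fun u => ¬ IsFar G c a b d u) (fun u => (F u).card)
    ⟨c, by simpa using fun h : IsFar G c a b d c => h.ne_c rfl⟩
  simp only [Finset.mem_filter, Finset.mem_univ, true_and] at hu₁ hmax₁
  have near : ∀ v, ¬ IsFar G c a b d v → v ≠ c → v ≠ a → v ≠ b → v ≠ d →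
      G.Adj c v ∨ G.Adj a v ∨ G.Adj b v ∨ G.Adj d v := by
    intro v hv h1 h2 h3 h4
    by_contra hno
    push Not at hno
    exact hv ⟨h1, h2, h3, h4, hno.1, hno.2.1, hno.2.2.1, hno.2.2.2⟩
  by_cases hcov : ∀ v, IsFar G c a b d v → G.Adj u₁ v
  · refine ⟨{c, a, b, d, u₁}, Finset.card_le_five, ?_⟩
    intro v
    by_cases hv : IsFar G c a b d v
    · exact .inr ⟨u₁, by simp, hcov v hv⟩
    · have := near v hv
      simp only [Finset.mem_insert, Finset.mem_singleton, exists_eq_or_imp, exists_eq_left]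
      tauto
  push Not at hcov
  obtain ⟨v₂, hv₂, h12⟩ := hcov
  obtain ⟨w, hw, hwv⟩ := hk.exists_adj_of_far hG hbull hchair hv₂
  obtain ⟨u₂, hu₂, hmax₂⟩ := Finset.exists_max_image
    (Finset.univ.filter fun u => ¬ IsFar G c a b d u ∧ G.Adj u v₂) (fun u => (F u).card)
    ⟨w, by simp [hw, hwv]⟩
  simp only [Finset.mem_filter, Finset.mem_univ, true_and] at hu₂ hmax₂
  obtain ⟨hu₂, h22⟩ := hu₂
  obtain ⟨v₁, hv1, hv1'⟩ := notsub (hmax₁ u₂ hu₂) ((memF _ _).2 ⟨hv₂, h22⟩)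
    (fun h => h12 ((memF _ _).1 h).2)
  obtain ⟨hv₁, h11⟩ := (memF _ _).1 hv1
  have h21 : ¬ G.Adj u₂ v₁ := fun h => hv1' ((memF _ _).2 ⟨hv₁, h⟩)
  refine ⟨{a, b, d, u₁, u₂}, Finset.card_le_five, ?_⟩
  intro v
  by_cases hv : IsFar G c a b d v
  · by_contra hno
    have h13 : ¬ G.Adj u₁ v := fun h => hno (.inr ⟨u₁, by simp, h⟩)
    have h23 : ¬ G.Adj u₂ v := fun h => hno (.inr ⟨u₂, by simp, h⟩)
    obtain ⟨u₃, hu₃, h33⟩ := hk.exists_adj_of_far hG hbull hchair hv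
    obtain ⟨w₁, hw1, hw1'⟩ := notsub (hmax₁ u₃ hu₃) ((memF _ _).2 ⟨hv, h33⟩)
      (fun h => h13 ((memF _ _).1 h).2)
    obtain ⟨hw₁, k11⟩ := (memF _ _).1 hw1
    have k31 : ¬ G.Adj u₃ w₁ := fun h => hw1' ((memF _ _).2 ⟨hw₁, h⟩)
    -- The choice of `u₂` is maximal only among neighbors of `v₂`; if `u₃` is not one of them, `v₂`
    -- itself is private to `u₂`.
    obtain ⟨w₂, hw₂, k22, k32⟩ : ∃ w₂, IsFar G c a b d w₂ ∧ G.Adj u₂ w₂ ∧ ¬ G.Adj u₃ w₂ := by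
      by_cases h32 : G.Adj u₃ v₂
      · obtain ⟨w₂, hw2, hw2'⟩ := notsub (hmax₂ u₃ ⟨hu₃, h32⟩) ((memF _ _).2 ⟨hv, h33⟩)
          (fun h => h23 ((memF _ _).1 h).2)
        obtain ⟨hw₂, k22⟩ := (memF _ _).1 hw2
        exact ⟨w₂, hw₂, k22, fun h => hw2' ((memF _ _).2 ⟨hw₂, h⟩)⟩
      · exact ⟨v₂, hv₂, h22, h32⟩
    obtain ⟨x, -, -, -, hux, -, hx, -⟩ := hk.exists_two_leaves hbull hchair hu₁ hv₁ h11
    exact hchair.not_chair hux.symm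
      (hk.adj_leaf_of_private hbull hchair hu₁ hu₂ hv₁ hv₂ h11 h22 h12 h21 hx hux).symm
      (hk.adj_leaf_of_private hbull hchair hu₁ hu₃ hw₁ hv k11 h33 h13 k31 hx hux).symm h33
      (fun h => h12 (h ▸ h22))
      (hk.not_adj_of_private hbull hchair hu₁ hu₂ hv₁ hv₂ h11 h22 h12 h21)
      (hk.not_adj_of_private hbull hchair hu₁ hu₃ hw₁ hv k11 h33 h13 k31)
      (hk.not_adj_of_private hbull hchair hu₂ hu₃ hw₂ hv k22 h33 h23 k32)
      (hv.not_adj_leaf hx) h13 h23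
  · have h1 := near v hv
    have h2 := hk.adj_leaf_or_of_adj_center hbull hchair hu₁ hu₂ hv₁ hv₂ h11 h22 h12 h21 (w := v)
    have h3 := hk.ca.symm
    simp only [Finset.mem_insert, Finset.mem_singleton, exists_eq_or_imp, exists_eq_left]
    by_cases hvc : v = c
    · subst hvc
      exact .inr (.inl h3)
    · tauto

end Claw

/-! ### Claw-free graphs: finding an induced path on five vertices -/

section InducedPath

variable {V : Type*} {G : SimpleGraph V}

theorem exists_dominating_of_forall_triple [Nonempty V]
    (h : ∀ a b d, a ≠ b → a ≠ d → b ≠ d → G.Adj a b ∨ G.Adj a d ∨ G.Adj b d) :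
    ∃ S : Finset V, S.card ≤ 5 ∧ ∀ v, v ∈ S ∨ ∃ s ∈ S, G.Adj s v := by
  classical
  by_cases hab : ∃ a b, a ≠ b ∧ ¬ G.Adj a b
  · obtain ⟨a, b, hne, hab⟩ := hab
    refine ⟨{a, b}, Finset.card_le_two.trans (by norm_num), fun v => ?_⟩
    have := h a b v hne
    simp only [Finset.mem_insert, Finset.mem_singleton, exists_eq_or_imp, exists_eq_left]
    grind
  · push Not at hab
    obtain ⟨a⟩ := ‹Nonempty V›
    refine ⟨{a}, by simp, fun v => ?_⟩
    simp only [Finset.mem_singleton, exists_eq_left]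
    by_cases hv : v = a
    · exact .inl hv
    · exact .inr (hab a v (Ne.symm hv))

/-- The vertices `q 0, …, q n` induce a path. -/
structure IsInducedPath (G : SimpleGraph V) (n : ℕ) (q : ℕ → V) : Prop where
  adj_iff : ∀ i j, i ≤ n → j ≤ n → (G.Adj (q i) (q j) ↔ i + 1 = j ∨ j + 1 = i)
  inj : ∀ i j, i ≤ n → j ≤ n → q i = q j → i = j

theorem IsInducedPath.reverse {n : ℕ} {q : ℕ → V} (hq : IsInducedPath G n q) :
    IsInducedPath G n fun i => q (n - i) where
  adj_iff i j hi hj := by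
    rw [hq.adj_iff _ _ (by omega) (by omega)]
    omega
  inj i j hi hj h := by
    have := hq.inj _ _ (by omega) (by omega) h
    omega

theorem IsInducedPath.append {n : ℕ} {q : ℕ → V} (hq : IsInducedPath G n q) {v : V}
    (hne : ∀ i ≤ n, v ≠ q i) (hadj : ∀ i ≤ n, G.Adj v (q i) ↔ i = n) :
    IsInducedPath G (n + 1) fun i => if i = n + 1 then v else q i where
  adj_iff i j hi hj := by
    by_cases h1 : i = n + 1 <;> by_cases h2 : j = n + 1
    · simp [h1, h2]
    · simp only [h1, h2, if_true, if_false, hadj j (by omega)]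
      omega
    · simp only [h1, h2, if_true, if_false, G.adj_comm (q i), hadj i (by omega)]
      omega
    · simp only [h1, h2, if_false]
      exact hq.adj_iff i j (by omega) (by omega)
  inj i j hi hj h := by
    by_cases h1 : i = n + 1 <;> by_cases h2 : j = n + 1 <;> simp only [h1, h2, if_true, if_false] at h
    · omega
    · exact (hne j (by omega) h).elim
    · exact (hne i (by omega) h.symm).elim
    · exact hq.inj i j (by omega) (by omega) h

/-- A finite graph with an induced path on five vertices has a longest one. -/
theorem exists_maximal_inducedPath [Fintype V] (h : ∃ q, IsInducedPath G 4 q) :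
    ∃ n q, 4 ≤ n ∧ IsInducedPath G n q ∧ ¬ ∃ q', IsInducedPath G (n + 1) q' := by
  by_contra hno
  push Not at hno
  have all : ∀ m, ∃ q, IsInducedPath G (m + 4) q := by
    intro m
    induction m with
    | zero => exact h
    | succ m ih =>
      obtain ⟨q, hq⟩ := ih
      exact hno (m + 4) q (by omega) hq
  obtain ⟨q, hq⟩ := all (Fintype.card V)
  have hinj : Function.Injective fun i : Fin (Fintype.card V + 1) => q i := by
    intro i j hij
    exact Fin.ext (hq.inj i j (by omega) (by omega) hij)
  have := Fintype.card_le_of_injective _ hinj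
  simp at this

/-- If a connected graph has an independent triple, then it has one in which two of the vertices
have a common neighbor. -/
theorem exists_triple_with_common_neighbor (hG : G.Connected) {a b d : V} (hab' : a ≠ b)
    (had' : a ≠ d) (hbd' : b ≠ d) (hab : ¬ G.Adj a b) (had : ¬ G.Adj a d) (hbd : ¬ G.Adj b d) :
    ∃ a b d s, a ≠ b ∧ a ≠ d ∧ b ≠ d ∧ ¬ G.Adj a b ∧ ¬ G.Adj a d ∧ ¬ G.Adj b d ∧ G.Adj s a ∧
      G.Adj s b := by
  -- A vertex `t` at distance two from `a`. Either some `w` completes `a`, `t` to an independent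
  -- triple, or `t` is a common neighbor of `b` and `d`.
  obtain ⟨s, t, hs, hst, ht⟩ : ∃ s t, G.Adj a s ∧ G.Adj s t ∧ t ≠ a ∧ ¬ G.Adj a t := by
    by_contra hno
    have := forall_of_connected hG (p := fun v => v = a ∨ G.Adj a v) (r := a) (.inl rfl)
      (by
        intro u v hu huv
        rcases hu with rfl | hu
        · exact .inr huv
        · by_contra hv
          push Not at hv
          exact hno ⟨u, v, hu, huv, hv⟩) b
    rcases this with h | h
    · exact hab' h.symm
    · exact hab h
  obtain ⟨hta, hat⟩ := ht
  by_cases h : ∃ w, w ≠ a ∧ w ≠ t ∧ ¬ G.Adj a w ∧ ¬ G.Adj t w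
  · obtain ⟨w, h1, h2, h3, h4⟩ := h
    exact ⟨a, t, w, s, hta.symm, h1.symm, h2.symm, hat, h3, h4, hs.symm, hst⟩
  · push Not at h
    have hbt : b ≠ t := by
      rintro rfl
      exact hbd (h d had'.symm hbd'.symm had)
    have hdt : d ≠ t := by
      rintro rfl
      exact hbd (h b hab'.symm hbd' hab).symm
    exact ⟨b, d, a, t, hbd', hab'.symm, had'.symm, hbd, fun h => hab h.symm, fun h => had h.symm,
      h b hab'.symm hbt hab, h d had'.symm hdt had⟩

theorem isInducedPath_of_five {v₀ v₁ v₂ v₃ v₄ : V} (h01 : G.Adj v₀ v₁) (h12 : G.Adj v₁ v₂)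
    (h23 : G.Adj v₂ v₃) (h34 : G.Adj v₃ v₄) (h02 : ¬ G.Adj v₀ v₂) (h03 : ¬ G.Adj v₀ v₃)
    (h04 : ¬ G.Adj v₀ v₄) (h13 : ¬ G.Adj v₁ v₃) (h14 : ¬ G.Adj v₁ v₄) (h24 : ¬ G.Adj v₂ v₄) :
    ∃ q, IsInducedPath G 4 q := by
  refine ⟨fun i => match i with | 0 => v₀ | 1 => v₁ | 2 => v₂ | 3 => v₃ | _ => v₄, ?_, ?_⟩
  · intro i j hi hj
    interval_cases i <;> interval_cases j <;>
      simp [h01, h12, h23, h34, h02, h03, h04, h13, h14, h24, h01.symm, h12.symm, h23.symm,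
        h34.symm, G.adj_comm v₂ v₀, G.adj_comm v₃ v₀, G.adj_comm v₄ v₀, G.adj_comm v₃ v₁,
        G.adj_comm v₄ v₁, G.adj_comm v₄ v₂]
  · intro i j hi hj h
    interval_cases i <;> interval_cases j <;> simp at h ⊢ <;> subst h <;> simp_all [G.adj_comm]

/-- A connected (claw, bull)-free graph with an independent triple has an induced path on five
vertices. -/
theorem exists_inducedPath_four (hG : G.Connected) (hbull : IsFree bull G)
    (hclaw : ∀ c a b d, ¬ IsClaw G c a b d) {a b d : V} (hab' : a ≠ b) (had' : a ≠ d)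
    (hbd' : b ≠ d) (hab : ¬ G.Adj a b) (had : ¬ G.Adj a d) (hbd : ¬ G.Adj b d) :
    ∃ q, IsInducedPath G 4 q := by
  obtain ⟨a, b, d, s, hab', had', hbd', hab, had, hbd, hsa, hsb⟩ :=
    exists_triple_with_common_neighbor hG hab' had' hbd' hab had hbd
  have hsd : ¬ G.Adj s d := fun hsd => hclaw s a b d ⟨hsa, hsb, hsd, hab', had', hbd', hab, had, hbd⟩
  -- By connectivity an edge leaves the union of the neighborhoods of `a`, `b`, `s` (with `s`
  -- added), since `d` lies outside. If `u` sees both or neither of `a`, `b`, there is a claw; if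
  -- exactly one, a bull or the desired path, depending on whether `u` sees `s`.
  obtain ⟨u, w, hu, huw, hw⟩ : ∃ u w, (u = s ∨ G.Adj a u ∨ G.Adj b u ∨ G.Adj s u) ∧ G.Adj u w ∧
      ¬ (w = s ∨ G.Adj a w ∨ G.Adj b w ∨ G.Adj s w) := by
    by_contra hno
    have := forall_of_connected hG (p := fun v => v = s ∨ G.Adj a v ∨ G.Adj b v ∨ G.Adj s v)
      (r := s) (.inl rfl) (by
        intro u v hu huv
        by_contra hv
        exact hno ⟨u, v, hu, huv, hv⟩) d
    rcases this with rfl | h | h | h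
    exacts [had hsa.symm, had h, hbd h, hsd h]
  push Not at hw
  obtain ⟨hws, haw, hbw, hsw⟩ := hw
  have hus : u ≠ s := by rintro rfl; exact hsw huw
  have hua : u ≠ a := by rintro rfl; exact haw huw
  have hub : u ≠ b := by rintro rfl; exact hbw huw
  have hwa : w ≠ a := by rintro rfl; exact hsw hsa
  have hwb : w ≠ b := by rintro rfl; exact hsw hsb
  by_cases hau : G.Adj a u <;> by_cases hbu : G.Adj b u
  · exact (hclaw u w a b ⟨huw, hau.symm, hbu.symm, hwa, hwb, hab', fun h => haw h.symm,
      fun h => hbw h.symm, hab⟩).elim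
  · by_cases hsu : G.Adj s u
    · exact (hbull.not_bull hsb.symm hsu huw hsa.symm hau hbu hbw hsw hab haw).elim
    · exact isInducedPath_of_five huw.symm hau.symm hsa.symm hsb (fun h => haw h.symm)
        (fun h => hsw h.symm) (fun h => hbw h.symm) (fun h => hsu h.symm) (fun h => hbu h.symm) hab
  · by_cases hsu : G.Adj s u
    · exact (hbull.not_bull hsa.symm hsu huw hsb.symm hbu hau haw hsw (fun h => hab h.symm)
        hbw).elim
    · exact isInducedPath_of_five huw.symm hbu.symm hsb.symm hsa (fun h => hbw h.symm)
        (fun h => hsw h.symm) (fun h => haw h.symm) (fun h => hsu h.symm) (fun h => hau h.symm)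
        (fun h => hab h.symm)
  · have hsu : G.Adj s u := by tauto
    exact (hclaw s a b u ⟨hsa, hsb, hsu, hab', hua.symm, hub.symm, hab, hau, hbu⟩).elim

end InducedPath

/-! ### Claw-free graphs: structure around a longest induced path -/

section Blowup

variable {V : Type*} {G : SimpleGraph V}

/-- `v` is a true twin of `q j` with respect to the path `q 0, …, q n`. -/
structure IsTwinAt (G : SimpleGraph V) (n : ℕ) (q : ℕ → V) (v : V) (j : ℕ) : Prop where
  le : j ≤ n
  eq_or_adj : v = q j ∨ G.Adj v (q j)
  adj_iff : ∀ i ≤ n, i ≠ j → (G.Adj v (q i) ↔ i + 1 = j ∨ j + 1 = i)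

/-- `v` is adjacent to the two ends of the path `q 0, …, q n` and to no other vertex of it. -/
def ClosesCycle (G : SimpleGraph V) (n : ℕ) (q : ℕ → V) (v : V) : Prop :=
  ∀ i ≤ n, G.Adj v (q i) ↔ i = 0 ∨ i = n

variable {n : ℕ} {q : ℕ → V}

theorem IsInducedPath.isTwinAt_self (hq : IsInducedPath G n q) {j : ℕ} (hj : j ≤ n) :
    IsTwinAt G n q (q j) j :=
  ⟨hj, .inl rfl, fun i hi _ => by rw [hq.adj_iff j i hj hi]; omega⟩

theorem IsInducedPath.eq_of_isTwinAt (hq : IsInducedPath G n q) {i j : ℕ} (hi : i ≤ n)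
    (h : IsTwinAt G n q (q i) j) : i = j := by
  rcases h.eq_or_adj with h' | h'
  · exact hq.inj i j hi h.le h'
  · by_contra hne
    rw [hq.adj_iff i j hi h.le] at h'
    exact G.irrefl ((h.adj_iff i hi hne).2 (by omega))

/-- Claws and bulls force the neighbors of `v` on the path to be the closed neighborhood of one path
vertex, a single end, or the two ends. A single end would extend the path, against maximality. -/
theorem IsInducedPath.isTwinAt_or_closesCycle (hq : IsInducedPath G n q) (hn : 4 ≤ n)
    (hbull : IsFree bull G) (hclaw : ∀ c a b d, ¬ IsClaw G c a b d)
    (hmax : ¬ ∃ q', IsInducedPath G (n + 1) q') {v : V} (hv : ∃ i ≤ n, G.Adj v (q i)) :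
    (∃ j, IsTwinAt G n q v j) ∨ ClosesCycle G n q v := by
  by_cases hvq : ∃ i ≤ n, v = q i
  · obtain ⟨i, hi, rfl⟩ := hvq
    exact .inl ⟨i, hq.isTwinAt_self hi⟩
  push Not at hvq
  have claw : ∀ {i j k}, i ≤ n → j ≤ n → k ≤ n → (i + 1 = j ∨ j + 1 = i) →
      (i + 1 = k ∨ k + 1 = i) → j ≠ k → G.Adj v (q i) → ¬ G.Adj v (q j) → G.Adj v (q k) := by
    intro i j k hi hj hk hij hik hjk hvi hvj
    by_contra hvk
    refine hclaw (q i) v (q j) (q k) ⟨hvi.symm, (hq.adj_iff i j hi hj).2 hij,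
      (hq.adj_iff i k hi hk).2 hik, hvq j hj, hvq k hk, fun h => hjk (hq.inj j k hj hk h), hvj, hvk,
      ?_⟩
    rw [hq.adj_iff j k hj hk]
    omega
  have claw' : ∀ {i j k}, i ≤ n → j ≤ n → k ≤ n → i + 1 < j → j + 1 < k → G.Adj v (q i) →
      G.Adj v (q j) → ¬ G.Adj v (q k) := by
    intro i j k hi hj hk hij hjk hvi hvj hvk
    refine hclaw v (q i) (q j) (q k) ⟨hvi, hvj, hvk, ?_, ?_, ?_, ?_, ?_, ?_⟩
    · intro h; have := hq.inj i j hi hj h; omega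
    · intro h; have := hq.inj i k hi hk h; omega
    · intro h; have := hq.inj j k hj hk h; omega
    · rw [hq.adj_iff i j hi hj]; omega
    · rw [hq.adj_iff i k hi hk]; omega
    · rw [hq.adj_iff j k hj hk]; omega
  -- a triangle `v, q i, q j` with pendants `q k` at `q i` and `q l` at `v`
  have bull₁ : ∀ {i j k l}, i ≤ n → j ≤ n → k ≤ n → l ≤ n → (i + 1 = j ∨ j + 1 = i) →
      (i + 1 = k ∨ k + 1 = i) → j ≠ k → (l + 1 < k ∨ k + 1 < l) → (l + 1 < i ∨ i + 1 < l) →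
      (l + 1 < j ∨ j + 1 < l) →
      G.Adj v (q i) → G.Adj v (q j) → ¬ G.Adj v (q k) → ¬ G.Adj v (q l) := by
    intro i j k l hi hj hk hl hij hik hjk hlk hli hlj hvi hvj hvk hvl
    refine hbull.not_bull (p := q k) (q := q i) (r := v) (s := q l) (t := q j) ?_ hvi.symm hvl ?_
      hvj.symm (fun h => hvk h.symm) ?_ ?_ ?_ ?_
    · rw [hq.adj_iff k i hk hi]; omega
    · rw [hq.adj_iff j i hj hi]; omega
    · rw [hq.adj_iff k l hk hl]; omega
    · rw [hq.adj_iff i l hi hl]; omega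
    · rw [hq.adj_iff j k hj hk]; omega
    · rw [hq.adj_iff j l hj hl]; omega
  -- the path `q i, …, q (i + 3)` with `v` adjacent to its middle edge
  have bull₂ : ∀ {i}, i + 3 ≤ n → ¬ G.Adj v (q i) → G.Adj v (q (i + 1)) → G.Adj v (q (i + 2)) →
      G.Adj v (q (i + 3)) := by
    intro i hi h0 h1 h2
    by_contra h3
    refine hbull.not_bull (p := q i) (q := q (i + 1)) (r := q (i + 2)) (s := q (i + 3)) (t := v)
      ?_ ?_ ?_ h1 h2 ?_ ?_ ?_ h0 h3 <;> rw [hq.adj_iff _ _ (by omega) (by omega)] <;> omega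
  have single : ∀ m, m = 0 ∨ m = n → ¬ ∀ i ≤ n, G.Adj v (q i) ↔ i = m := by
    rintro m (rfl | rfl) h
    · refine hmax ⟨_, hq.reverse.append (v := v) (fun i _ => hvq _ (by omega)) ?_⟩
      intro i hi
      rw [h _ (by omega)]
      omega
    · exact hmax ⟨_, hq.append hvq h⟩
  have twin : ∀ j ≤ n, (∀ i ≤ n, G.Adj v (q i) ↔ i ≤ j + 1 ∧ j ≤ i + 1) → IsTwinAt G n q v j := by
    intro j hj h
    refine ⟨hj, .inr ((h j hj).2 (by omega)), fun i hi hij => ?_⟩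
    rw [h i hi]
    omega
  classical
  obtain ⟨hi, hvi⟩ := Nat.find_spec hv
  have hmin : ∀ k, k < Nat.find hv → k ≤ n → ¬ G.Adj v (q k) := fun k hk hkn h =>
    Nat.find_min hv hk ⟨hkn, h⟩
  generalize Nat.find hv = i at hi hvi hmin
  -- Here `q i` is the first neighbor of `v`. If `0 < i < n`, then `v` is a twin of `q (i + 1)`; the
  -- end `q 0` needs its own case analysis, where the closed cycle arises.
  rcases Nat.eq_zero_or_pos i with rfl | hi0
  · by_cases h1 : G.Adj v (q 1)
    · by_cases h2 : G.Adj v (q 2)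
      · have h3 : ¬ G.Adj v (q 3) := fun h3 => by
          by_cases h4 : G.Adj v (q 4)
          · exact claw' hi (by omega : 2 ≤ n) hn (by omega) (by omega) hvi h2 h4
          · exact bull₁ (by omega : 3 ≤ n) (by omega : 2 ≤ n) hn hi (by omega) (by omega) (by omega)
              (by omega) (by omega) (by omega) h3 h2 h4 hvi
        refine .inl ⟨1, twin 1 (by omega) fun k hk => ?_⟩
        rcases (by omega : k = 0 ∨ k = 1 ∨ k = 2 ∨ k = 3 ∨ 4 ≤ k) with rfl | rfl | rfl | rfl | hk4
        · simpa using hvi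
        · simpa using h1
        · simpa using h2
        · simpa using h3
        · exact iff_of_false (claw' hi (by omega : 2 ≤ n) hk (by omega) (by omega) hvi h2) (by omega)
      · have h4 : ∀ k ≤ n, 4 ≤ k → ¬ G.Adj v (q k) := fun k hk hk4 =>
          bull₁ (by omega : 1 ≤ n) hi (by omega : 2 ≤ n) hk (by omega) (by omega) (by omega)
            (by omega) (by omega) (by omega) h1 hvi h2
        have h3 : ¬ G.Adj v (q 3) := fun h3 => h4 4 hn le_rfl
          (claw (by omega : 3 ≤ n) (by omega : 2 ≤ n) hn (by omega) (by omega) (by omega) h3 h2)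
        refine .inl ⟨0, twin 0 hi fun k hk => ?_⟩
        rcases (by omega : k = 0 ∨ k = 1 ∨ k = 2 ∨ k = 3 ∨ 4 ≤ k) with rfl | rfl | rfl | rfl | hk4
        · simpa using hvi
        · simpa using h1
        · simpa using h2
        · simpa using h3
        · exact iff_of_false (h4 k hk hk4) (by omega)
    · by_cases hk : ∃ k, 1 ≤ k ∧ k ≤ n ∧ G.Adj v (q k)
      · right
        obtain ⟨hk1, hkn, hvk⟩ := Nat.find_spec hk
        have hkmin : ∀ l, 1 ≤ l → l < Nat.find hk → l ≤ n → ¬ G.Adj v (q l) := fun l hl hlk hln h =>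
          Nat.find_min hk hlk ⟨hl, hln, h⟩
        generalize Nat.find hk = k at hk1 hkn hvk hkmin
        have hk2 : 2 ≤ k := by
          by_contra hlt
          obtain rfl : k = 1 := by omega
          exact h1 hvk
        obtain rfl : k = n := by
          by_contra hne
          have hpred := hkmin (k - 1) (by omega) (by omega) (by omega)
          have hsucc := claw hkn (by omega : k - 1 ≤ n) (by omega : k + 1 ≤ n)
            (by omega) (by omega) (by omega) hvk hpred
          by_cases hk3 : 3 ≤ k
          · exact bull₁ hkn (by omega : k + 1 ≤ n) (by omega : k - 1 ≤ n) hi (by omega) (by omega)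
              (by omega) (by omega) (by omega) (by omega) hvk hsucc hpred hvi
          · obtain rfl : k = 2 := by omega
            by_cases h4 : G.Adj v (q 4)
            · exact claw' hi hkn hn (by omega) (by omega) hvi hvk h4
            · exact bull₁ (by omega : 3 ≤ n) hkn hn hi (by omega) (by omega) (by omega)
                (by omega) (by omega) (by omega) hsucc hvk h4 hvi
        intro l hl
        rcases (by omega : l = 0 ∨ l = k ∨ 1 ≤ l ∧ l < k) with rfl | rfl | hlk
        · exact iff_of_true hvi (by omega)
        · exact iff_of_true hvk (by omega)
        · exact iff_of_false (hkmin l hlk.1 hlk.2 hl) (by omega)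
      · refine (single 0 (by omega) fun k hkn => ?_).elim
        by_cases h : k = 0
        · subst h
          exact iff_of_true hvi rfl
        · exact iff_of_false (fun h' => hk ⟨k, by omega, hkn, h'⟩) h
  · have hpred := hmin (i - 1) (by omega) (by omega)
    by_cases hin : i = n
    · subst hin
      refine (single i (by omega) fun k hk => ?_).elim
      by_cases h : k = i
      · subst h
        exact iff_of_true hvi rfl
      · exact iff_of_false (hmin k (by omega) hk) h
    have hsucc := claw hi (by omega : i - 1 ≤ n) (by omega : i + 1 ≤ n) (by omega) (by omega)
      (by omega) hvi hpred
    refine .inl ⟨i + 1, twin (i + 1) (by omega) fun k hk => ?_⟩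
    rcases (by omega : k < i ∨ k = i ∨ k = i + 1 ∨ k = i + 2 ∨ i + 3 ≤ k) with
      h | rfl | rfl | rfl | h
    · exact iff_of_false (hmin k h hk) (by omega)
    · exact iff_of_true hvi (by omega)
    · exact iff_of_true hsucc (by omega)
    · refine iff_of_true ?_ (by omega)
      have := bull₂ (i := i - 1) (by omega) hpred
      rw [show i - 1 + 1 = i by omega, show i - 1 + 2 = i + 1 by omega,
        show i - 1 + 3 = i + 2 by omega] at this
      exact this hvi hsucc
    · exact iff_of_false (bull₁ hi (by omega : i + 1 ≤ n) (by omega : i - 1 ≤ n) hk (by omega)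
        (by omega) (by omega) (by omega) (by omega) (by omega) hvi hsucc hpred) (by omega)

/-- The path dominates. Suppose `v` sees it and a neighbor `w` of `v` does not: nonadjacent path
neighbors of `v` give a claw with `w`, and two consecutive ones force a third through a bull. -/
theorem IsInducedPath.isTwinAt_or_closesCycle_of_connected (hq : IsInducedPath G n q) (hn : 4 ≤ n)
    (hG : G.Connected) (hbull : IsFree bull G) (hclaw : ∀ c a b d, ¬ IsClaw G c a b d)
    (hmax : ¬ ∃ q', IsInducedPath G (n + 1) q') (v : V) :
    (∃ j, IsTwinAt G n q v j) ∨ ClosesCycle G n q v := by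
  refine hq.isTwinAt_or_closesCycle hn hbull hclaw hmax
    (forall_of_connected hG (p := fun v => ∃ i ≤ n, G.Adj v (q i)) (r := q 0)
      ⟨1, by omega, (hq.adj_iff 0 1 (by omega) (by omega)).2 (by omega)⟩ ?_ v)
  intro v w hv hvw
  by_contra hw
  push Not at hw
  have far : ∀ i ≤ n, w ≠ q i := by
    rintro i hi rfl
    by_cases h : i = 0
    · exact hw 1 (by omega) ((hq.adj_iff _ _ hi (by omega)).2 (by omega))
    · exact hw (i - 1) (by omega) ((hq.adj_iff _ _ hi (by omega)).2 (by omega))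
  have claw : ∀ i j, i ≤ n → j ≤ n → i + 1 < j → G.Adj v (q i) → ¬ G.Adj v (q j) := by
    intro i j hi hj hij hvi hvj
    refine hclaw v w (q i) (q j) ⟨hvw, hvi, hvj, far i hi, far j hj, ?_, hw i hi, hw j hj, ?_⟩
    · intro h; have := hq.inj i j hi hj h; omega
    · rw [hq.adj_iff i j hi hj]; omega
  have bull : ∀ i j k, i ≤ n → j ≤ n → k ≤ n → (i + 1 = j ∨ j + 1 = i) → (j + 1 = k ∨ k + 1 = j) →
      i ≠ k → G.Adj v (q i) → G.Adj v (q j) → G.Adj v (q k) := by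
    intro i j k hi hj hk hij hjk hik hvi hvj
    by_contra hvk
    refine hbull.not_bull (p := w) (q := v) (r := q j) (s := q k) (t := q i) hvw.symm hvj ?_ hvi.symm
      ?_ (hw j hj) (hw k hk) hvk (fun h => hw i hi h.symm) ?_
    · rw [hq.adj_iff j k hj hk]; omega
    · rw [hq.adj_iff i j hi hj]; omega
    · rw [hq.adj_iff i k hi hk]; omega
  rcases hq.isTwinAt_or_closesCycle hn hbull hclaw hmax hv with ⟨j, hj⟩ | hz
  · have hjn := hj.le
    have hadj : G.Adj v (q j) := by
      rcases hj.eq_or_adj with rfl | h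
      · exact (hw j hjn hvw.symm).elim
      · exact h
    by_cases h0 : j = 0
    · subst h0
      have h1 := (hj.adj_iff 1 (by omega) (by omega)).2 (by omega)
      have h2 := bull 0 1 2 (by omega) (by omega) (by omega) (by omega) (by omega) (by omega) hadj h1
      exact claw 0 2 (by omega) (by omega) (by omega) hadj h2
    · have h1 := (hj.adj_iff (j - 1) (by omega) (by omega)).2 (by omega)
      by_cases h2 : j = n
      · have h2 := bull j (j - 1) (j - 2) (by omega) (by omega) (by omega) (by omega) (by omega)
          (by omega) hadj h1
        exact claw (j - 2) j (by omega) (by omega) (by omega) h2 hadj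
      · exact claw (j - 1) (j + 1) (by omega) (by omega) (by omega) h1
          ((hj.adj_iff (j + 1) (by omega) (by omega)).2 (by omega))
  · exact claw 0 n (by omega) (by omega) (by omega) ((hz 0 (by omega)).2 (by omega))
      ((hz n (by omega)).2 (by omega))

/-- Nonadjacent twins of `q j` form a claw at a path neighbor of `q j`, with the next path vertex as
third leaf. -/
theorem IsInducedPath.adj_of_isTwinAt_same (hq : IsInducedPath G n q) (hn : 4 ≤ n)
    (hclaw : ∀ c a b d, ¬ IsClaw G c a b d) {u v : V} {j : ℕ} (huv : u ≠ v)
    (hu : IsTwinAt G n q u j) (hv : IsTwinAt G n q v j) : G.Adj u v := by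
  by_contra hadj
  have hj := hu.le
  have key : ∀ i k, i ≤ n → k ≤ n → (i + 1 = j ∨ j + 1 = i) → (i + 1 = k ∨ k + 1 = i) → k ≠ j →
      False := by
    intro i k hi hk hij hik hkj
    have hne : ∀ u, IsTwinAt G n q u j → u ≠ q k := by
      rintro u hu rfl
      exact hkj (hq.eq_of_isTwinAt hk hu)
    refine hclaw (q i) u v (q k) ⟨((hu.adj_iff i hi (by omega)).2 hij).symm,
      ((hv.adj_iff i hi (by omega)).2 hij).symm, (hq.adj_iff i k hi hk).2 hik, huv, hne u hu, hne v hv,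
      hadj, ?_, ?_⟩
    · rw [hu.adj_iff k hk hkj]; omega
    · rw [hv.adj_iff k hk hkj]; omega
  by_cases h : 2 ≤ j
  · exact key (j - 1) (j - 2) (by omega) (by omega) (by omega) (by omega) (by omega)
  · exact key (j + 1) (j + 2) (by omega) (by omega) (by omega) (by omega) (by omega)

/-- Otherwise two further path vertices on one side complete a bull. There is room on the left if `2
≤ j`, and on the right if not, because `4 ≤ n`. -/
theorem IsInducedPath.adj_of_isTwinAt_succ (hq : IsInducedPath G n q) (hn : 4 ≤ n)
    (hbull : IsFree bull G) {u v : V} {j : ℕ}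
    (hu : IsTwinAt G n q u j) (hv : IsTwinAt G n q v (j + 1)) : G.Adj u v := by
  by_contra hadj
  have hj := hv.le
  have hu' : G.Adj u (q j) := by
    rcases hu.eq_or_adj with rfl | h
    · exact (hadj ((hv.adj_iff j (by omega) (by omega)).2 (by omega)).symm).elim
    · exact h
  have hv' : G.Adj v (q (j + 1)) := by
    rcases hv.eq_or_adj with rfl | h
    · exact (hadj ((hu.adj_iff (j + 1) (by omega) (by omega)).2 (by omega))).elim
    · exact h
  by_cases h : 2 ≤ j
  · refine hbull.not_bull (p := q (j - 2)) (q := q (j - 1)) (r := q j) (s := v) (t := u)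
      ?_ ?_ ?_ ?_ hu' ?_ ?_ ?_ ?_ hadj
    · rw [hq.adj_iff _ _ (by omega) (by omega)]; omega
    · rw [hq.adj_iff _ _ (by omega) (by omega)]; omega
    · rw [G.adj_comm, hv.adj_iff _ (by omega) (by omega)]; omega
    · rw [hu.adj_iff _ (by omega) (by omega)]; omega
    · rw [hq.adj_iff _ _ (by omega) (by omega)]; omega
    · rw [G.adj_comm, hv.adj_iff _ (by omega) (by omega)]; omega
    · rw [G.adj_comm, hv.adj_iff _ (by omega) (by omega)]; omega
    · rw [hu.adj_iff _ (by omega) (by omega)]; omega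
  · refine hbull.not_bull (p := q (j + 3)) (q := q (j + 2)) (r := q (j + 1)) (s := u) (t := v)
      ?_ ?_ ?_ ?_ hv' ?_ ?_ ?_ ?_ (fun h => hadj h.symm)
    · rw [hq.adj_iff _ _ (by omega) (by omega)]; omega
    · rw [hq.adj_iff _ _ (by omega) (by omega)]; omega
    · rw [G.adj_comm, hu.adj_iff _ (by omega) (by omega)]; omega
    · rw [hv.adj_iff _ (by omega) (by omega)]; omega
    · rw [hq.adj_iff _ _ (by omega) (by omega)]; omega
    · rw [G.adj_comm, hu.adj_iff _ (by omega) (by omega)]; omega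
    · rw [G.adj_comm, hu.adj_iff _ (by omega) (by omega)]; omega
    · rw [hv.adj_iff _ (by omega) (by omega)]; omega

/-- From the last few path vertices, `z` looks like a vertex at position `n + 1`, and the same bull
appears. -/
theorem IsInducedPath.adj_of_isTwinAt_last (hq : IsInducedPath G n q) (hn : 4 ≤ n)
    (hbull : IsFree bull G) {v z : V}
    (hv : IsTwinAt G n q v n) (hz : ClosesCycle G n q z) : G.Adj v z := by
  by_contra hadj
  have hv' : G.Adj v (q n) := by
    rcases hv.eq_or_adj with rfl | h
    · exact (hadj ((hz n le_rfl).2 (by omega)).symm).elim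
    · exact h
  refine hbull.not_bull (p := q (n - 2)) (q := q (n - 1)) (r := q n) (s := z) (t := v)
    ?_ ?_ ?_ ?_ hv' ?_ ?_ ?_ ?_ hadj
  · rw [hq.adj_iff _ _ (by omega) (by omega)]; omega
  · rw [hq.adj_iff _ _ (by omega) (by omega)]; omega
  · rw [G.adj_comm, hz _ (by omega)]; omega
  · rw [hv.adj_iff _ (by omega) (by omega)]; omega
  · rw [hq.adj_iff _ _ (by omega) (by omega)]; omega
  · rw [G.adj_comm, hz _ (by omega)]; omega
  · rw [G.adj_comm, hz _ (by omega)]; omega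
  · rw [hv.adj_iff _ (by omega) (by omega)]; omega

theorem IsInducedPath.adj_of_closesCycle (hq : IsInducedPath G n q) (hn : 4 ≤ n)
    (hclaw : ∀ c a b d, ¬ IsClaw G c a b d) {y z : V} (hyz : y ≠ z)
    (hy : ClosesCycle G n q y) (hz : ClosesCycle G n q z) : G.Adj y z := by
  by_contra hadj
  have hne : ∀ z, ClosesCycle G n q z → z ≠ q 1 := by
    rintro z hz rfl
    have := (hz n le_rfl).2 (by omega)
    rw [hq.adj_iff 1 n (by omega) le_rfl] at this
    omega
  refine hclaw (q 0) y z (q 1) ⟨((hy 0 (by omega)).2 (by omega)).symm,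
    ((hz 0 (by omega)).2 (by omega)).symm, (hq.adj_iff 0 1 (by omega) (by omega)).2 (by omega), hyz,
    hne y hy, hne z hz, hadj, ?_, ?_⟩
  · rw [hy 1 (by omega)]; omega
  · rw [hz 1 (by omega)]; omega

/-- A connected (claw, bull)-free graph with an independent triple has a Hamiltonian path. -/
theorem exists_hamiltonian_list_of_claw_free [Fintype V] (hG : G.Connected)
    (hbull : IsFree bull G) (hclaw : ∀ c a b d, ¬ IsClaw G c a b d) {a b d : V} (hab' : a ≠ b)
    (had' : a ≠ d) (hbd' : b ≠ d) (hab : ¬ G.Adj a b) (had : ¬ G.Adj a d) (hbd : ¬ G.Adj b d) :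
    ∃ l : List V, l.IsChain G.Adj ∧ l.Nodup ∧ ∀ v, v ∈ l := by
  obtain ⟨n, q, hn, hq, hmax⟩ := exists_maximal_inducedPath
    (exists_inducedPath_four hG hbull hclaw hab' had' hbd' hab had hbd)
  -- Vertices closing the cycle receive level `n + 1`. Their adjacency to level `0` is irrelevant,
  -- since only a Hamiltonian path is needed.
  have hex : ∀ v, ∃ j, IsTwinAt G n q v j ∨ (j = n + 1 ∧ ClosesCycle G n q v) := by
    intro v
    rcases hq.isTwinAt_or_closesCycle_of_connected hn hG hbull hclaw hmax v with ⟨j, hj⟩ | hz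
    · exact ⟨j, .inl hj⟩
    · exact ⟨n + 1, .inr ⟨rfl, hz⟩⟩
  choose f hf using hex
  have hle : ∀ v, f v ≤ n + 1 := by
    intro v
    rcases hf v with h | h
    · have := h.le
      omega
    · omega
  have htwin : ∀ v, f v ≤ n → IsTwinAt G n q v (f v) := fun v hv => (hf v).resolve_right (by omega)
  have hlast : ∀ v, f v = n + 1 → ClosesCycle G n q v := by
    intro v hv
    rcases hf v with h | h
    · have := h.le
      omega
    · exact h.2
  have hfq : ∀ i ≤ n, f (q i) = i := by
    intro i hi
    rcases hf (q i) with h | h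
    · exact (hq.eq_of_isTwinAt hi h).symm
    · have h0 := (h.2 0 (by omega)).2 (by omega)
      have h1 := (h.2 n (by omega)).2 (by omega)
      rw [hq.adj_iff _ _ (by omega) (by omega)] at h0 h1
      omega
  have hsame : ∀ u v, u ≠ v → f u = f v → G.Adj u v := by
    intro u v huv h
    by_cases hu : f u ≤ n
    · exact hq.adj_of_isTwinAt_same hn hclaw huv (htwin u hu) (h ▸ htwin v (h ▸ hu))
    · have := hle u
      exact hq.adj_of_closesCycle hn hclaw huv (hlast u (by omega)) (hlast v (by omega))
  have hsucc : ∀ u v, f v = f u + 1 → G.Adj u v := by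
    intro u v h
    have := hle v
    have hu := htwin u (by omega)
    by_cases hv : f v ≤ n
    · exact hq.adj_of_isTwinAt_succ hn hbull hu (h ▸ htwin v hv)
    · have hun : f u = n := by omega
      exact hq.adj_of_isTwinAt_last hn hbull (hun ▸ hu) (hlast v (by omega))
  by_cases hz : ∃ v, f v = n + 1
  · obtain ⟨l, h1, h2, h3⟩ := exists_hamiltonian_list_of_levels f (n + 1) hsame hsucc (by
      intro i hi
      by_cases h : i ≤ n
      · exact ⟨q i, hfq i h⟩
      · obtain ⟨v, hv⟩ := hz
        exact ⟨v, by omega⟩)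
    exact ⟨l, h1, h2, fun v => (h3 v).2 (hle v)⟩
  · push Not at hz
    obtain ⟨l, h1, h2, h3⟩ := exists_hamiltonian_list_of_levels f n hsame hsucc
      fun i hi => ⟨q i, hfq i hi⟩
    refine ⟨l, h1, h2, fun v => (h3 v).2 ?_⟩
    have := hle v
    have := hz v
    omega

end Blowup

end LongestPaths

theorem mainTheorem3 {V : Type*} [Fintype V] (G : SimpleGraph V) (hconn : G.Connected)
    (hbull : LongestPaths.IsFree LongestPaths.bull G)
    (hchair : LongestPaths.IsFree LongestPaths.chair G) :
    LongestPaths.lpt G ≤ 5 := by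
  suffices h : ∃ S : Finset V, S.card ≤ 5 ∧ LongestPaths.IsLongestPathTransversal G S by
    obtain ⟨S, hS, hT⟩ := h
    exact hT.lpt_le.trans hS
  have dom : (∃ S : Finset V, S.card ≤ 5 ∧ ∀ v, v ∈ S ∨ ∃ s ∈ S, G.Adj s v) →
      ∃ S : Finset V, S.card ≤ 5 ∧ LongestPaths.IsLongestPathTransversal G S :=
    fun ⟨S, hS, hd⟩ => ⟨S, hS, LongestPaths.isLongestPathTransversal_of_dominating hd⟩
  have := hconn.nonempty
  by_cases hclaw : ∀ c a b d, ¬ LongestPaths.IsClaw G c a b d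
  · by_cases htriple : ∀ a b d, a ≠ b → a ≠ d → b ≠ d → G.Adj a b ∨ G.Adj a d ∨ G.Adj b d
    · exact dom (LongestPaths.exists_dominating_of_forall_triple htriple)
    · push Not at htriple
      obtain ⟨a, b, d, hab', had', hbd', hab, had, hbd⟩ := htriple
      obtain ⟨l, h1, h2, h3⟩ := LongestPaths.exists_hamiltonian_list_of_claw_free hconn hbull hclaw
        hab' had' hbd' hab had hbd
      exact ⟨{a}, by simp, LongestPaths.isLongestPathTransversal_singleton_of_isChain h1 h2 h3 a⟩
  · push Not at hclaw
    obtain ⟨c, a, b, d, hk⟩ := hclaw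
    exact dom (hk.exists_dominating hconn hbull hchair)
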